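/- Let $d\in\mathbb N$, let $\mathbb H^2_d=\ell^2(\mathbb F^d)$ be the full Fock space over $\mathbb C^d$ (square-summable families indexed by the words in $d$ letters, with standard basis $\{e_\alpha\}$ and vacuum vector $1=e_\emptyset$), and let $L_1,\dots,L_d$ be the left free shifts, $L_ke_\alpha=e_{k\alpha}$. Let $\mathcal A_d$ be the operator-norm closed unital algebra generated by $L_1,\dots,L_d$, and let $\mathscr A_d=(\mathcal A_d+\mathcal A_d^*)^{-\|\cdot\|}$ be the free disk system; one has $\mathcal A_d^*\mathcal A_d\subseteq\mathscr A_d$. A (positive) NC measure is a linear functional $\mu:\mathscr A_d\to\mathbb C$ with $\mu(s)\ge 0$ for every positive operator $s\in\mathscr A_d$; write $\mu\le\nu$ if $\mu(s)\le\nu(s)$ for all such $s$. A positive form $q$ in $\mathbb H^2_d$ is a positive semi-definite sesquilinear form with dense domain $\mathrm{Dom}\,q$. It is closed if $\mathrm{Dom}\,q$ is complete in the norm $(q(x,x)+\|x\|^2)^{1/2}$, and closable if it has a closed extension. Write $q_1\le q_2$ if $\mathrm{Dom}\,q_2\subseteq\mathrm{Dom}\,q_1$ and $q_1(h,h)\le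 q_2(h,h)$ for all $h\in\mathrm{Dom}\,q_2$. Call $q$ singular if every closable positive form $q'\le q$ is identically zero. Identifying $a\in\mathcal A_d$ with the vector $a1\in\mathbb H^2_d$, each NC measure $\mu$ defines the positive form $q_\mu(a_1,a_2)=\mu(a_1^*a_2)$ with domain $\mathcal A_d$. The NC measure $\mu$ is absolutely continuous if $q_\mu$ is closable, and singular if $q_\mu$ is singular. **Theorem (Non-commutative Lebesgue decomposition).** For every NC measure $\mu$ there are NC measures $\mu_{ac},\mu_s\le\mu$ with $$\mu=\mu_{ac}+\mu_s$$ such that $\mu_{ac}$ is the maximal (that is, the largest) absolutely continuous NC measure bounded above by $\mu$, its form $q_{\mu_{ac}}$ is the largest closable positive form bounded above by $q_\mu$, and $\mu_s$ is singular. This decomposition is unique: if $\mu=\nu+\sigma$ with NC measures $\nu,\sigma$ such that $\nu$ is maximal among the absolutely continuous NC measures bounded above by $\mu$, then $\nu=\mu_{ac}$ and $\sigma=\mu_s$. -/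

import Mathlib

open scoped ComplexOrder

noncomputable section

namespace NCLebesgue

/-! ### The full Fock space and the left free shifts -/

/-- The full Fock space over `ℂ^d`, realised as the square-summable families indexed by the free
monoid on `d` letters (whose elements are the words in these letters). -/
abbrev Fock (d : ℕ) : Type := lp (fun _ : FreeMonoid (Fin d) => ℂ) 2

/-- The isometry of `ℓ²(words)` induced by an injective map of words: `e_w ↦ e_{φ w}`. -/
def wordIsometry {d : ℕ} (φ : FreeMonoid (Fin d) → FreeMonoid (Fin d))
    (hφ : Function.Injective φ) : Fock d →ₗᵢ[ℂ] Fock d where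
  toFun f := ⟨Function.extend φ f 0, by
    have h : Summable fun w => ‖f w‖ ^ (2 : ENNReal).toReal := (lp.memℓp f).summable (by simp)
    refine memℓp_gen ((hφ.summable_iff ?_).mp ?_)
    · intro w hw
      rw [Function.extend_apply' _ _ _ (by simpa using hw)]
      simp
    · simpa only [Function.comp_def, hφ.extend_apply] using h⟩
  map_add' f g := by
    ext w
    by_cases hw : ∃ v, φ v = w
    · obtain ⟨v, rfl⟩ := hw
      simp only [lp.coeFn_add, Pi.add_apply, hφ.extend_apply]
    · simp only [lp.coeFn_add, Pi.add_apply, Function.extend_apply' _ _ _ hw, Pi.zero_apply,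
        add_zero]
  map_smul' c f := by
    ext w
    by_cases hw : ∃ v, φ v = w
    · obtain ⟨v, rfl⟩ := hw
      simp only [lp.coeFn_smul, Pi.smul_apply, hφ.extend_apply, RingHom.id_apply]
    · simp only [lp.coeFn_smul, Pi.smul_apply, Function.extend_apply' _ _ _ hw, Pi.zero_apply,
        smul_zero]
  norm_map' f := by
    rw [lp.norm_eq_tsum_rpow (by simp), lp.norm_eq_tsum_rpow (by simp)]
    congr 1
    symm
    have h := hφ.tsum_eq
      (f := fun w => ‖(Function.extend φ f 0 : FreeMonoid (Fin d) → ℂ) w‖ ^ (2 : ENNReal).toReal) ?_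
    · simp only [hφ.extend_apply] at h
      exact h
    · intro w hw
      by_contra hne
      apply hw
      simp only
      rw [Function.extend_apply' _ _ _ (by simpa using hne)]
      simp

theorem wordIsometry_apply {d : ℕ} {φ : FreeMonoid (Fin d) → FreeMonoid (Fin d)}
    (hφ : Function.Injective φ) (f : Fock d) (w : FreeMonoid (Fin d)) :
    wordIsometry φ hφ f (φ w) = f w :=
  hφ.extend_apply _ _ _

theorem wordIsometry_apply' {d : ℕ} {φ : FreeMonoid (Fin d) → FreeMonoid (Fin d)}
    (hφ : Function.Injective φ) (f : Fock d) {w : FreeMonoid (Fin d)} (hw : ¬∃ v, φ v = w) :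
    wordIsometry φ hφ f w = 0 :=
  Function.extend_apply' _ _ _ hw

instance (d : ℕ) : DecidableEq (FreeMonoid (Fin d)) :=
  inferInstanceAs (DecidableEq (List (Fin d)))

/-- The standard orthonormal basis vector `e_w`. -/
def basisVec {d : ℕ} (w : FreeMonoid (Fin d)) : Fock d := lp.single 2 w (1 : ℂ)

/-- The vacuum vector `1`, the basis vector of the empty word. -/
def vacuum (d : ℕ) : Fock d := basisVec 1

theorem wordIsometry_basisVec {d : ℕ} {φ : FreeMonoid (Fin d) → FreeMonoid (Fin d)}
    (hφ : Function.Injective φ) (v : FreeMonoid (Fin d)) :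
    wordIsometry φ hφ (basisVec v) = basisVec (φ v) := by
  ext w
  by_cases hw : ∃ u, φ u = w
  · obtain ⟨u, rfl⟩ := hw
    rw [wordIsometry_apply]
    simp [basisVec, Pi.single_apply, hφ.eq_iff]
  · rw [wordIsometry_apply' hφ _ hw]
    have : w ≠ φ v := fun h => hw ⟨v, h.symm⟩
    simp [basisVec, this]

/-- The left free shift `L_k`, determined by `L_k e_w = e_{k w}`. -/
def leftShift (d : ℕ) (k : Fin d) : Fock d →L[ℂ] Fock d :=
  (wordIsometry (fun w => FreeMonoid.of k * w) (mul_right_injective _)).toContinuousLinearMap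

/-! ### The free disk algebra and the free disk system -/

/-- The free disk algebra `𝒜_d`: the operator-norm closed unital algebra generated by the left
free shifts. -/
def freeDiskAlgebra (d : ℕ) : Subalgebra ℂ (Fock d →L[ℂ] Fock d) :=
  (Algebra.adjoin ℂ (Set.range (leftShift d))).topologicalClosure

/-- The set `{star a | a ∈ M}` of adjoints of a subspace of operators, as a subspace. -/
def adjointSubmodule {d : ℕ} (M : Submodule ℂ (Fock d →L[ℂ] Fock d)) :
    Submodule ℂ (Fock d →L[ℂ] Fock d) :=
  M.map (starLinearEquiv ℂ : (Fock d →L[ℂ] Fock d) ≃ₗ⋆[ℂ] (Fock d →L[ℂ] Fock d)).toLinearMap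

/-- The free disk system: the operator-norm closure of `𝒜_d + 𝒜_d^*`. -/
def freeDiskSystem (d : ℕ) : Submodule ℂ (Fock d →L[ℂ] Fock d) :=
  ((freeDiskAlgebra d).toSubmodule ⊔
    adjointSubmodule (freeDiskAlgebra d).toSubmodule).topologicalClosure

theorem star_mem_adjointSubmodule {d : ℕ} {M : Submodule ℂ (Fock d →L[ℂ] Fock d)}
    {a : Fock d →L[ℂ] Fock d} (ha : a ∈ M) : star a ∈ adjointSubmodule M :=
  ⟨a, ha, rfl⟩

theorem star_leftShift_mul_self {d : ℕ} (k : Fin d) :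
    star (leftShift d k) * leftShift d k = 1 := by
  ext1 f
  refine ext_inner_left ℂ fun g => ?_
  rw [mul_apply_eq_comp, ContinuousLinearMap.star_eq_adjoint,
    ContinuousLinearMap.adjoint_inner_right]
  exact LinearIsometry.inner_map_map _ _ _

theorem star_leftShift_mul_of_ne {d : ℕ} {j k : Fin d} (hjk : j ≠ k) :
    star (leftShift d j) * leftShift d k = 0 := by
  ext1 f
  refine ext_inner_left ℂ fun g => ?_
  rw [mul_apply_eq_comp, ContinuousLinearMap.star_eq_adjoint,
    ContinuousLinearMap.adjoint_inner_right, zero_apply, inner_zero_right,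
    lp.inner_eq_tsum]
  refine (tsum_congr fun w => ?_).trans tsum_zero
  by_cases hw : ∃ v, FreeMonoid.of k * v = w
  · have hw' : ¬∃ v, FreeMonoid.of j * v = w := by
      rintro ⟨u, hu⟩
      obtain ⟨v, hv⟩ := hw
      have h := congrArg FreeMonoid.toList (hu.trans hv.symm)
      simp only [FreeMonoid.toList_mul, FreeMonoid.toList_of, List.cons_append,
        List.nil_append, List.cons.injEq] at h
      exact hjk h.1
    have h0 : leftShift d j g w = 0 := wordIsometry_apply' (mul_right_injective _) _ hw'
    rw [h0, inner_zero_left]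
  · have h0 : leftShift d k f w = 0 := wordIsometry_apply' (mul_right_injective _) _ hw
    rw [h0, inner_zero_right]

/-- The monomial `L^α` for a word `α`, given as a list of letters. -/
def monomial (d : ℕ) (α : List (Fin d)) : Fock d →L[ℂ] Fock d := (α.map (leftShift d)).prod

theorem monomial_mem_adjoin {d : ℕ} (α : List (Fin d)) :
    monomial d α ∈ Algebra.adjoin ℂ (Set.range (leftShift d)) :=
  Subalgebra.list_prod_mem _ fun x hx => by
    obtain ⟨k, -, rfl⟩ := List.mem_map.mp hx
    exact Algebra.subset_adjoin ⟨k, rfl⟩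

theorem adjoin_eq_span_monomial (d : ℕ) :
    (Algebra.adjoin ℂ (Set.range (leftShift d))).toSubmodule =
      Submodule.span ℂ (Set.range (monomial d)) := by
  apply le_antisymm
  · rw [Algebra.adjoin_eq_span]
    refine Submodule.span_mono fun x hx => ?_
    obtain ⟨l, hl, rfl⟩ := Submonoid.exists_list_of_mem_closure hx
    clear hx
    induction l with
    | nil => exact ⟨[], rfl⟩
    | cons y l ih =>
      obtain ⟨α, hα⟩ := ih fun z hz => hl z (List.mem_cons_of_mem _ hz)
      obtain ⟨k, hk⟩ := hl y List.mem_cons_self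
      exact ⟨k :: α, by simp only [monomial, List.map_cons, List.prod_cons] at hα ⊢; rw [hα, hk]⟩
  · rw [Submodule.span_le]
    rintro _ ⟨α, rfl⟩
    exact monomial_mem_adjoin α

theorem star_monomial_mul_monomial_mem {d : ℕ} (α β : List (Fin d)) :
    star (monomial d α) * monomial d β ∈
      (Algebra.adjoin ℂ (Set.range (leftShift d))).toSubmodule ⊔
        adjointSubmodule (Algebra.adjoin ℂ (Set.range (leftShift d))).toSubmodule := by
  induction α generalizing β with
  | nil =>
    refine Submodule.mem_sup_left ?_
    simpa [monomial] using monomial_mem_adjoin β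
  | cons j α ih =>
    cases β with
    | nil =>
      refine Submodule.mem_sup_right ?_
      have h := star_mem_adjointSubmodule
        (M := (Algebra.adjoin ℂ (Set.range (leftShift d))).toSubmodule)
        (monomial_mem_adjoin (j :: α))
      have h1 : monomial d [] = 1 := rfl
      rwa [h1, mul_one]
    | cons k β =>
      have h1 : star (monomial d (j :: α)) * monomial d (k :: β) =
          star (monomial d α) * (star (leftShift d j) * leftShift d k) * monomial d β := by
        simp only [monomial, List.map_cons, List.prod_cons, star_mul, mul_assoc]
      rw [h1]
      by_cases hjk : j = k
      · subst hjk
        rw [star_leftShift_mul_self, mul_one]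
        exact ih β
      · rw [star_leftShift_mul_of_ne hjk, mul_zero, zero_mul]
        exact Submodule.zero_mem _

theorem star_mul_mem_of_mem_span {d : ℕ} {x y : Fock d →L[ℂ] Fock d}
    (hx : x ∈ Submodule.span ℂ (Set.range (monomial d)))
    (hy : y ∈ Submodule.span ℂ (Set.range (monomial d))) :
    star x * y ∈
      (Algebra.adjoin ℂ (Set.range (leftShift d))).toSubmodule ⊔
        adjointSubmodule (Algebra.adjoin ℂ (Set.range (leftShift d))).toSubmodule := by
  induction hx using Submodule.span_induction with
  | mem x hx =>
    obtain ⟨α, rfl⟩ := hx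
    induction hy using Submodule.span_induction with
    | mem y hy =>
      obtain ⟨β, rfl⟩ := hy
      exact star_monomial_mul_monomial_mem α β
    | zero => rw [mul_zero]; exact Submodule.zero_mem _
    | add y z _ _ h1 h2 => rw [mul_add]; exact Submodule.add_mem _ h1 h2
    | smul c y _ h1 => rw [mul_smul_comm]; exact Submodule.smul_mem _ _ h1
  | zero => rw [star_zero, zero_mul]; exact Submodule.zero_mem _
  | add x z _ _ h1 h2 => rw [star_add, add_mul]; exact Submodule.add_mem _ h1 h2
  | smul c x _ h1 => rw [star_smul, smul_mul_assoc]; exact Submodule.smul_mem _ _ h1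

/-- The semi-Dirichlet property: `𝒜_d^* 𝒜_d` is contained in the free disk system. -/
theorem star_mul_mem_freeDiskSystem {d : ℕ} {a b : Fock d →L[ℂ] Fock d}
    (ha : a ∈ freeDiskAlgebra d) (hb : b ∈ freeDiskAlgebra d) :
    star a * b ∈ freeDiskSystem d := by
  have hPA : (Algebra.adjoin ℂ (Set.range (leftShift d))).toSubmodule ≤
      (freeDiskAlgebra d).toSubmodule := Subalgebra.le_topologicalClosure _
  have key : ∀ x ∈ Algebra.adjoin ℂ (Set.range (leftShift d)),
      ∀ y ∈ Algebra.adjoin ℂ (Set.range (leftShift d)), star x * y ∈ freeDiskSystem d := by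
    intro x hx y hy
    refine Submodule.le_topologicalClosure _ (sup_le_sup hPA (Submodule.map_mono hPA)
      (star_mul_mem_of_mem_span ?_ ?_))
    · rw [← adjoin_eq_span_monomial]; exact hx
    · rw [← adjoin_eq_span_monomial]; exact hy
  have hcl : IsClosed (freeDiskSystem d : Set (Fock d →L[ℂ] Fock d)) :=
    Submodule.isClosed_topologicalClosure _
  have hstar : Continuous fun x : Fock d →L[ℂ] Fock d => star x :=
    continuous_star (R := Fock d →L[ℂ] Fock d)
  have hc1 : ∀ y : Fock d →L[ℂ] Fock d,
      Continuous fun x : Fock d →L[ℂ] Fock d => star x * y :=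
    fun y => hstar.mul continuous_const
  have hc2 : ∀ x : Fock d →L[ℂ] Fock d,
      Continuous fun y : Fock d →L[ℂ] Fock d => star x * y :=
    fun x => continuous_const.mul continuous_id
  have hcl1 : ∀ y, IsClosed
      ((fun x : Fock d →L[ℂ] Fock d => star x * y) ⁻¹' freeDiskSystem d) :=
    fun y => IsClosed.preimage (hc1 y) hcl
  have hcl2 : ∀ x, IsClosed
      ((fun y : Fock d →L[ℂ] Fock d => star x * y) ⁻¹' freeDiskSystem d) :=
    fun x => IsClosed.preimage (hc2 x) hcl
  have step : ∀ y ∈ Algebra.adjoin ℂ (Set.range (leftShift d)), star a * y ∈ freeDiskSystem d :=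
    fun y hy => closure_minimal (fun x hx => key x hx y hy) (hcl1 y) ha
  exact closure_minimal (fun y hy => step y hy) (hcl2 a) hb

/-! ### Non-commutative measures -/

/-- A (positive) NC measure: a positive linear functional on the free disk system. -/
@[ext]
structure NCMeasure (d : ℕ) where
  /-- the underlying linear functional -/
  toFun : freeDiskSystem d →ₗ[ℂ] ℂ
  nonneg : ∀ s : freeDiskSystem d, (s : Fock d →L[ℂ] Fock d).IsPositive → 0 ≤ toFun s

instance (d : ℕ) : Add (NCMeasure d) where
  add μ ν := ⟨μ.toFun + ν.toFun, fun s hs => add_nonneg (μ.nonneg s hs) (ν.nonneg s hs)⟩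

/-- `μ ≤ ν` means that `ν - μ` is a positive functional. -/
instance (d : ℕ) : LE (NCMeasure d) where
  le μ ν := ∀ s : freeDiskSystem d, (s : Fock d →L[ℂ] Fock d).IsPositive → μ.toFun s ≤ ν.toFun s

/-! ### Positive semi-definite quadratic forms in a Hilbert space -/

/-- A densely defined positive semi-definite sesquilinear form in `H`, conjugate linear in its first
argument. -/
structure PosForm (H : Type*) [NormedAddCommGroup H] [InnerProductSpace ℂ H] where
  /-- the form domain -/
  dom : Submodule ℂ H
  dense : Dense (dom : Set H)
  /-- the sesquilinear form -/
  form : dom →ₗ⋆[ℂ] dom →ₗ[ℂ] ℂ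
  nonneg : ∀ x : dom, 0 ≤ form x x

namespace PosForm

variable {H : Type*} [NormedAddCommGroup H] [InnerProductSpace ℂ H]

/-- The squared norm `q(x, x) + ‖x‖²` of the inner product `⟨x, y⟩_{q+1}`. -/
def normSqAddOne (q : PosForm H) (x : q.dom) : ℝ := (q.form x x).re + ‖(x : H)‖ ^ 2

/-- A form is closed if its domain is complete for the norm of `⟨x, y⟩_{q+1}`: every Cauchy sequence
converges. -/
def IsClosed (q : PosForm H) : Prop :=
  ∀ x : ℕ → q.dom,
    (∀ ε > 0, ∃ N, ∀ m ≥ N, ∀ n ≥ N, q.normSqAddOne (x m - x n) < ε) →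
      ∃ y : q.dom, Filter.Tendsto (fun n => q.normSqAddOne (x n - y)) Filter.atTop (nhds 0)

/-- `q'` extends `q`. -/
def Extends (q' q : PosForm H) : Prop :=
  ∃ h : q.dom ≤ q'.dom, ∀ x y : q.dom,
    q'.form (Submodule.inclusion h x) (Submodule.inclusion h y) = q.form x y

/-- A form is closable (absolutely continuous) if it has a closed extension. -/
def IsClosable (q : PosForm H) : Prop := ∃ q' : PosForm H, q'.IsClosed ∧ q'.Extends q

/-- The order on forms: `q₁ ≤ q₂` if `Dom q₂ ⊆ Dom q₁` and `q₁(h, h) ≤ q₂(h, h)` on `Dom q₂`. -/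
instance : LE (PosForm H) where
  le q₁ q₂ := ∃ h : q₂.dom ≤ q₁.dom, ∀ x : q₂.dom,
    q₁.form (Submodule.inclusion h x) (Submodule.inclusion h x) ≤ q₂.form x x

/-- A form is singular if the only closable form bounded above by it is identically zero. -/
def IsSingular (q : PosForm H) : Prop :=
  ∀ q' : PosForm H, q'.IsClosable → q' ≤ q → ∀ x y : q'.dom, q'.form x y = 0

end PosForm

/-! ### The quadratic form of an NC measure -/

theorem hasSum_basisVec {d : ℕ} (f : Fock d) :
    HasSum (fun w : FreeMonoid (Fin d) => f w • basisVec w) f := by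
  have h := lp.hasSum_single (p := 2) (by simp) f
  convert h using 2 with w
  rw [basisVec, ← lp.single_smul, smul_eq_mul, mul_one]

/-- The embedding `a ↦ a 1` of the free disk algebra into the Fock space. -/
def evalVacuum (d : ℕ) : (freeDiskAlgebra d).toSubmodule →ₗ[ℂ] Fock d where
  toFun a := (a : Fock d →L[ℂ] Fock d) (vacuum d)
  map_add' _ _ := rfl
  map_smul' _ _ := rfl

theorem monomial_vacuum {d : ℕ} (w : FreeMonoid (Fin d)) :
    monomial d w.toList (vacuum d) = basisVec w := by
  induction w using FreeMonoid.inductionOn' with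
  | one => rfl
  | of_mul k w ih =>
    have h1 : monomial d (FreeMonoid.of k * w).toList = leftShift d k * monomial d w.toList := rfl
    rw [h1, mul_apply_eq_comp, ih]
    exact wordIsometry_basisVec (mul_right_injective _) _

/-- Elements of the free disk algebra commute with the right free shifts `e_v ↦ e_{v w}`. -/
theorem commute_right {d : ℕ} {a : Fock d →L[ℂ] Fock d} (ha : a ∈ freeDiskAlgebra d)
    (w : FreeMonoid (Fin d)) :
    a * (wordIsometry (fun v => v * w) (mul_left_injective w)).toContinuousLinearMap =
      (wordIsometry (fun v => v * w) (mul_left_injective w)).toContinuousLinearMap * a := by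
  set R := (wordIsometry (fun v => v * w) (mul_left_injective w)).toContinuousLinearMap with hR
  have hclosed : IsClosed {b : Fock d →L[ℂ] Fock d | b * R = R * b} :=
    isClosed_eq (continuous_id.mul continuous_const) (continuous_const.mul continuous_id)
  refine closure_minimal ?_ hclosed ha
  intro b hb
  simp only [Set.mem_ofPred_eq]
  induction hb using Algebra.adjoin_induction with
  | mem x hx =>
    obtain ⟨k, rfl⟩ := hx
    have hbasis : ∀ v, leftShift d k (R (basisVec v)) = R (leftShift d k (basisVec v)) := by
      intro v
      have h1 : ∀ u, R (basisVec u) = basisVec (u * w) := fun u => wordIsometry_basisVec (mul_left_injective w) _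
      have h2 : ∀ u, leftShift d k (basisVec u) = basisVec (FreeMonoid.of k * u) :=
        fun u => wordIsometry_basisVec (mul_right_injective _) _
      rw [h1, h2, h2, h1, mul_assoc]
    ext1 f
    have hs := hasSum_basisVec f
    have e1 := hs.mapL (leftShift d k * R)
    have e2 := hs.mapL (R * leftShift d k)
    refine e1.unique ?_
    convert e2 using 2 with v
    rw [map_smul, map_smul, mul_apply_eq_comp, mul_apply_eq_comp, hbasis]
  | algebraMap r => exact Algebra.commutes r R
  | add x y _ _ hx hy => rw [add_mul, mul_add, hx, hy]
  | mul x y _ _ hx hy => rw [mul_assoc, hy, ← mul_assoc, hx, mul_assoc]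

theorem evalVacuum_injective (d : ℕ) : Function.Injective (evalVacuum d) := by
  refine (injective_iff_map_eq_zero _).mpr fun a ha => ?_
  have h0 : (a : Fock d →L[ℂ] Fock d) (vacuum d) = 0 := ha
  have hb : ∀ w, (a : Fock d →L[ℂ] Fock d) (basisVec w) = 0 := by
    intro w
    have h := congrArg (fun T : Fock d →L[ℂ] Fock d => T (vacuum d)) (commute_right a.2 w)
    simp only [mul_apply_eq_comp, h0, map_zero] at h
    have h1 : (wordIsometry (fun v => v * w) (mul_left_injective w)) (vacuum d) = basisVec w :=
      (wordIsometry_basisVec (mul_left_injective w) _).trans (by rw [one_mul])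
    rw [← h1]
    exact h
  apply Subtype.ext
  ext1 f
  have e1 := (hasSum_basisVec f).mapL (a : Fock d →L[ℂ] Fock d)
  refine e1.unique ?_
  simp only [map_smul, hb, smul_zero]
  exact hasSum_zero

theorem dense_range_evalVacuum (d : ℕ) :
    Dense ((LinearMap.range (evalVacuum d) : Submodule ℂ (Fock d)) : Set (Fock d)) := by
  intro f
  refine mem_closure_of_tendsto (hasSum_basisVec f) (Filter.Eventually.of_forall fun s => ?_)
  refine Submodule.sum_mem _ fun w _ => Submodule.smul_mem _ _ ?_
  exact ⟨⟨monomial d w.toList, Subalgebra.le_topologicalClosure _ (monomial_mem_adjoin _)⟩,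
    monomial_vacuum w⟩

/-- The free disk algebra, identified with the subspace `{a 1 | a ∈ 𝒜_d}` of the Fock space. -/
def diskEquiv (d : ℕ) :
    (freeDiskAlgebra d).toSubmodule ≃ₗ[ℂ] LinearMap.range (evalVacuum d) :=
  LinearEquiv.ofInjective (evalVacuum d) (evalVacuum_injective d)

namespace NCMeasure

variable {d : ℕ}

/-- The sesquilinear form `(a₁, a₂) ↦ μ (a₁^* a₂)` on the free disk algebra. -/
def preForm (μ : NCMeasure d) :
    (freeDiskAlgebra d).toSubmodule →ₗ⋆[ℂ] (freeDiskAlgebra d).toSubmodule →ₗ[ℂ] ℂ :=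
  LinearMap.mk₂'ₛₗ (starRingEnd ℂ) (RingHom.id ℂ)
    (fun a b => μ.toFun ⟨star (a : Fock d →L[ℂ] Fock d) * (b : Fock d →L[ℂ] Fock d),
      star_mul_mem_freeDiskSystem a.2 b.2⟩)
    (fun a a' b => by
      refine (congrArg μ.toFun (Subtype.ext ?_)).trans (map_add μ.toFun _ _)
      change star ((a : Fock d →L[ℂ] Fock d) + a') * (b : Fock d →L[ℂ] Fock d) = star _ * _ + star _ * _
      rw [star_add, add_mul])
    (fun c a b => by
      refine (congrArg μ.toFun (Subtype.ext ?_)).trans (map_smul μ.toFun _ _)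
      change star (c • (a : Fock d →L[ℂ] Fock d)) * (b : Fock d →L[ℂ] Fock d) = star c • (star _ * _)
      rw [star_smul, smul_mul_assoc])
    (fun a b b' => by
      refine (congrArg μ.toFun (Subtype.ext ?_)).trans (map_add μ.toFun _ _)
      change star (a : Fock d →L[ℂ] Fock d) * ((b : Fock d →L[ℂ] Fock d) + b') = star _ * _ + star _ * _
      rw [mul_add])
    (fun c a b => by
      refine (congrArg μ.toFun (Subtype.ext ?_)).trans (map_smul μ.toFun _ _)
      change star (a : Fock d →L[ℂ] Fock d) * (c • (b : Fock d →L[ℂ] Fock d)) = c • (star _ * _)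
      rw [mul_smul_comm])

/-- The quadratic form `q_μ(a₁, a₂) = μ (a₁^* a₂)` in the Fock space, with form domain `𝒜_d`. -/
def quadForm (μ : NCMeasure d) : PosForm (Fock d) where
  dom := LinearMap.range (evalVacuum d)
  dense := dense_range_evalVacuum d
  form := ((μ.preForm).comp (diskEquiv d).symm.toLinearMap).compl₂ (diskEquiv d).symm.toLinearMap
  nonneg x := by
    refine μ.nonneg _ ?_
    exact ContinuousLinearMap.isPositive_adjoint_comp_self _

theorem quadForm_apply (μ : NCMeasure d) (a b : (freeDiskAlgebra d).toSubmodule) :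
    μ.quadForm.form (diskEquiv d a) (diskEquiv d b) =
      μ.toFun ⟨star (a : Fock d →L[ℂ] Fock d) * (b : Fock d →L[ℂ] Fock d),
        star_mul_mem_freeDiskSystem a.2 b.2⟩ := by
  change μ.preForm ((diskEquiv d).symm (diskEquiv d a)) ((diskEquiv d).symm (diskEquiv d b)) = _
  rw [LinearEquiv.symm_apply_apply, LinearEquiv.symm_apply_apply]
  rfl

/-- `μ` is absolutely continuous (with respect to NC Lebesgue measure) if `q_μ` is closable. -/
def IsAC (μ : NCMeasure d) : Prop := μ.quadForm.IsClosable

/-- `μ` is singular (with respect to NC Lebesgue measure) if `q_μ` is singular. -/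
def IsSingular (μ : NCMeasure d) : Prop := μ.quadForm.IsSingular

end NCMeasure

end NCLebesgue

end

/-!
Write `B` for the bounded operators on the Fock space `H`. By the M. Riesz extension theorem an NC
measure `μ` extends to a positive functional on `B`, and the GNS construction yields a
representation `π` of `B` on a Hilbert space `K` and a vector `ξ` with `μ s = ⟪ξ, π s ξ⟫`, hence
`q_μ(a, b) = ⟪π a ξ, π b ξ⟫`. Working with a representation of all of `B`, instead of the completion
of `𝒜_d` for `q_μ`, makes the positivity of each functional `s ↦ ⟪η, π s η⟫` automatic.

Let `G ⊆ H × K` be the closure of the graph of `a 1 ↦ π a ξ`, and let `M = {k | (0, k) ∈ G}`. The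
form `q_μ` is closable exactly when `M = 0`. The point of the proof is that `M` reduces all
`π (L_j)`. Invariance under `π (L_j)` is immediate. For the adjoints, if `a ∈ 𝒜_d` has constant term
`c = ⟪1, a 1⟫`, then `L_j^* (a - c)` lies in `𝒜_d` again, and `c` depends continuously on `a 1`; so
`(x, k) ↦ (L_j^* (x - ⟪1, x⟫ 1), π (L_j^*) (k - ⟪1, x⟫ ξ))` maps `G` into itself, and over `x = 0` it
is `π (L_j^*)` (`map_star_leftShift_mem_singularSubspace`). Consequently, if `ξ = η + ζ` with
`ζ ∈ M` and `η ⊥ M`, then `π a ξ = π a η + π a ζ` is the orthogonal decomposition along `M` for every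
`a ∈ 𝒜_d`. The NC measures `μ_ac` and `μ_s` are those of the vectors `η` and `ζ`.

* `q_{μ_ac}` is closable since `G ∩ (H × Mᗮ)` is the graph of a closed operator that extends
  `a 1 ↦ π a η` (`isAC_vectorMeasure_regularVector`).
* For `k ∈ M` there are `b n ∈ 𝒜_d` with `b n 1 → 0` and `π (b n) ξ → k`. A closable form `q ≤ q_μ`
  satisfies `q(b n, b n) → 0`, so comparing `a` with `a - b n` gives
  `q(a, a) ≤ ‖π a ξ - k‖²` (`re_form_le_norm_sub_sq`). With `k = π a ζ` this is `q ≤ q_{μ_ac}`; the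
  same estimate for `ζ` in place of `ξ` gives the singularity of `μ_s`.
* That an absolutely continuous `ν ≤ μ` satisfies `ν ≤ μ_ac` on all positive elements of the free disk
  system, and not only on the squares `a^* a`, is seen by choosing the extension of `μ` as the sum
  of extensions of `ν` and `μ - ν`. With `b n` as above for `k = ζ`, the domination of `ν` by `μ` at
  `(t (1 - b n))^* (t (1 - b n))`, for arbitrary `t ∈ B`, becomes `ν (t^* t) ≤ ⟪η, π (t^* t) η⟫` in
  the limit (`vectorMeasure_le_regularVector`). The regular part does not depend on the chosen
  representation, because its form is the largest closable form below `q_μ` and an NC measure is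
  determined by its form.

Uniqueness is then formal: a maximal element of a set with a greatest element is that element.
-/

noncomputable section

open scoped InnerProductSpace Topology

open Filter

namespace NCLebesgue

section System

variable {d : ℕ}

/-! ### The free disk system is an operator system -/

theorem one_mem_freeDiskSystem : (1 : Fock d →L[ℂ] Fock d) ∈ freeDiskSystem d := by
  simpa using star_mul_mem_freeDiskSystem (one_mem (freeDiskAlgebra d)) (one_mem _)

theorem mem_freeDiskSystem_of_mem_freeDiskAlgebra {a : Fock d →L[ℂ] Fock d}
    (ha : a ∈ freeDiskAlgebra d) : a ∈ freeDiskSystem d := by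
  simpa using star_mul_mem_freeDiskSystem (one_mem (freeDiskAlgebra d)) ha

theorem star_mem_freeDiskSystem_of_mem_freeDiskAlgebra {a : Fock d →L[ℂ] Fock d}
    (ha : a ∈ freeDiskAlgebra d) : star a ∈ freeDiskSystem d := by
  simpa using star_mul_mem_freeDiskSystem ha (one_mem (freeDiskAlgebra d))

theorem freeDiskSystem_induction {p : (Fock d →L[ℂ] Fock d) → Prop}
    (hcl : IsClosed {s | p s}) (hadd : ∀ s t, p s → p t → p (s + t))
    (hmem : ∀ a ∈ freeDiskAlgebra d, p a) (hstar : ∀ a ∈ freeDiskAlgebra d, p (star a))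
    {s : Fock d →L[ℂ] Fock d} (hs : s ∈ freeDiskSystem d) : p s := by
  refine closure_minimal (fun x hx => ?_) hcl hs
  obtain ⟨a, ha, _, ⟨b, hb, rfl⟩, rfl⟩ := Submodule.mem_sup.mp hx
  exact hadd _ _ (hmem a ha) (hstar b hb)

theorem star_mem_freeDiskSystem {s : Fock d →L[ℂ] Fock d} (hs : s ∈ freeDiskSystem d) :
    star s ∈ freeDiskSystem d := by
  refine freeDiskSystem_induction (p := fun s => star s ∈ freeDiskSystem d) ?_ ?_ ?_ ?_ hs
  · exact (Submodule.isClosed_topologicalClosure _).preimage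
      (continuous_star (R := Fock d →L[ℂ] Fock d))
  · intro s t hs ht
    rw [star_add]
    exact add_mem hs ht
  · exact fun a ha => star_mem_freeDiskSystem_of_mem_freeDiskAlgebra ha
  · intro a ha
    rw [star_star]
    exact mem_freeDiskSystem_of_mem_freeDiskAlgebra ha

/-! ### Extension of positive functionals and the GNS representation -/

section OperatorSystem

variable {A : Type*} [CStarAlgebra A] [PartialOrder A] [StarOrderedRing A] {S : Submodule ℂ A}

theorem im_eq_zero_of_isSelfAdjoint (h1 : (1 : A) ∈ S) {f : S →ₗ[ℂ] ℂ}
    (hf : ∀ s : S, 0 ≤ (s : A) → 0 ≤ f s) (s : S) (hs : IsSelfAdjoint (s : A)) :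
    (f s).im = 0 := by
  let u : S := ((‖(s : A)‖ : ℝ) : ℂ) • ⟨1, h1⟩
  have hu : (u : A) = algebraMap ℝ _ ‖(s : A)‖ := by
    rw [Algebra.algebraMap_eq_smul_one]
    exact Complex.coe_smul _ _
  have h1 : 0 ≤ f u := hf u <| by
    rw [hu]
    exact algebraMap_nonneg _ (norm_nonneg _)
  have h2 : 0 ≤ f (u + s) := hf _ <| by
    rw [Submodule.coe_add, hu]
    exact neg_le_iff_add_nonneg'.mp hs.neg_algebraMap_norm_le_self
  have h3 := (Complex.nonneg_iff.mp h1).2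
  have h4 := (Complex.nonneg_iff.mp h2).2
  rw [map_add, Complex.add_im, ← h3, zero_add] at h4
  exact h4.symm

theorem re_nonneg_of_add_star_nonneg (h1 : (1 : A) ∈ S) (hstar : ∀ s ∈ S, star s ∈ S)
    {f : S →ₗ[ℂ] ℂ} (hf : ∀ s : S, 0 ≤ (s : A) → 0 ≤ f s) (s : S)
    (hs : 0 ≤ (s : A) + star (s : A)) : 0 ≤ (f s).re := by
  let t : S := ⟨star (s : A), hstar _ s.2⟩
  have h2 : (f (Complex.I • (s - t))).im = 0 := by
    refine im_eq_zero_of_isSelfAdjoint h1 hf _ ?_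
    change star (Complex.I • ((s : A) - star (s : A))) = Complex.I • ((s : A) - star (s : A))
    rw [star_smul, star_sub, star_star, Complex.star_def, Complex.conj_I, neg_smul, ← smul_neg,
      neg_sub]
  have h3 := (Complex.nonneg_iff.mp (hf (s + t) hs)).1
  rw [map_add, Complex.add_re] at h3
  simp only [map_smul, map_sub, smul_eq_mul, Complex.mul_im, Complex.I_re, Complex.I_im,
    Complex.sub_re, zero_mul, one_mul, zero_add] at h2
  linarith

/-- A positive functional on an operator system extends to the whole C⋆-algebra: the M. Riesz
extension theorem extends its real part along the cone of the elements with nonnegative real part,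
and the extension is complexified. -/
theorem exists_positive_extension (h1 : (1 : A) ∈ S) (hstar : ∀ s ∈ S, star s ∈ S)
    {f : S →ₗ[ℂ] ℂ} (hf : ∀ s : S, 0 ≤ (s : A) → 0 ≤ f s) :
    ∃ φ : A →ₚ[ℂ] ℂ, ∀ s : S, φ s = f s := by
  let C : PointedCone ℝ A :=
    { carrier := {b | 0 ≤ b + star b}
      add_mem' := fun {a b} ha hb => by
        have h : a + b + star (a + b) = (a + star a) + (b + star b) := by rw [star_add]; abel
        change 0 ≤ a + b + star (a + b)
        rw [h]
        exact add_nonneg ha hb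
      zero_mem' := by simp
      smul_mem' := fun c b hb => by
        change 0 ≤ (c : ℝ) • b + star ((c : ℝ) • b)
        rw [star_smul, star_trivial, ← smul_add]
        exact smul_nonneg c.2 hb }
  let fr : A →ₗ.[ℝ] ℝ :=
    { domain := S.restrictScalars ℝ
      toFun := Complex.reLm.comp (f.restrictScalars ℝ) }
  obtain ⟨g, hgf, hg⟩ := riesz_extension C fr
    (fun x hx => re_nonneg_of_add_star_nonneg h1 hstar hf x hx) (fun y => by
      refine ⟨⟨algebraMap ℝ _ ‖y + star y‖, ?_⟩, ?_⟩
      · change algebraMap ℝ _ ‖y + star y‖ ∈ S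
        rw [Algebra.algebraMap_eq_smul_one, ← Complex.coe_smul]
        exact Submodule.smul_mem _ _ h1
      · change 0 ≤ algebraMap ℝ _ ‖y + star y‖ + y + star (algebraMap ℝ _ ‖y + star y‖ + y)
        have h : 0 ≤ algebraMap ℝ A ‖y + star y‖ :=
          algebraMap_nonneg _ (norm_nonneg _)
        have h' : 0 ≤ algebraMap ℝ A ‖y + star y‖ + (y + star y) :=
          neg_le_iff_add_nonneg'.mp
            (IsSelfAdjoint.add_star_self y).neg_algebraMap_norm_le_self
        rw [star_add, h.isSelfAdjoint.star_eq]
        convert add_nonneg h' h using 1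
        abel)
  refine ⟨PositiveLinearMap.mk₀ (Module.Dual.extendRCLike (𝕜 := ℂ) g) fun b hb => ?_, fun s => ?_⟩
  · have hI : ∀ c : ℝ, 0 ≤ g (c • (Complex.I • b)) := fun c => hg _ <| by
      change 0 ≤ c • (Complex.I • b) + star (c • (Complex.I • b))
      rw [star_smul, star_smul, hb.isSelfAdjoint.star_eq, Complex.star_def, Complex.conj_I,
        star_trivial, neg_smul, smul_neg, add_neg_cancel]
    have h0 : g (Complex.I • b) = 0 := by
      have h2 := hI 1
      have h3 := hI (-1)
      rw [map_smul] at h2 h3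
      simp only [smul_eq_mul] at h2 h3
      linarith
    have hb' : 0 ≤ g b := hg _ <| by
      change 0 ≤ b + star b
      rw [hb.isSelfAdjoint.star_eq]
      exact add_nonneg hb hb
    rw [Module.Dual.extendRCLike_apply]
    simp only [RCLike.I_to_complex, h0]
    simpa using hb'
  · change Module.Dual.extendRCLike (𝕜 := ℂ) g (s : A) = f s
    have h2 : g (s : A) = (f s).re := hgf s
    have h3 : g (Complex.I • (s : A)) = (f (Complex.I • s)).re := hgf (Complex.I • s)
    rw [Module.Dual.extendRCLike_apply]
    simp only [RCLike.I_to_complex, h2, h3, map_smul]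
    apply Complex.ext <;> simp

end OperatorSystem

theorem NCMeasure.exists_positive_extension (μ : NCMeasure d) :
    ∃ φ : (Fock d →L[ℂ] Fock d) →ₚ[ℂ] ℂ, ∀ s : freeDiskSystem d, φ s = μ.toFun s :=
  NCLebesgue.exists_positive_extension one_mem_freeDiskSystem
    (fun _ hs => star_mem_freeDiskSystem hs)
    fun s hs => μ.nonneg s ((ContinuousLinearMap.nonneg_iff_isPositive _).mp hs)

/-- The GNS construction, with the class of `1` as the vector. -/
theorem exists_representation {A : Type} [CStarAlgebra A] [PartialOrder A] [StarOrderedRing A]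
    (φ : A →ₚ[ℂ] ℂ) :
    ∃ (K : Type) (_ : NormedAddCommGroup K) (_ : InnerProductSpace ℂ K) (_ : CompleteSpace K)
      (π : A →⋆ₐ[ℂ] (K →L[ℂ] K)) (ξ : K), ∀ b, φ b = ⟪ξ, π b ξ⟫_ℂ := by
  refine ⟨φ.GNS, inferInstance, inferInstance, inferInstance, φ.gnsStarAlgHom,
    (φ.toPreGNS 1 : φ.PreGNS), fun b => ?_⟩
  change φ b = ⟪((φ.toPreGNS 1 : φ.PreGNS) : φ.GNS),
    φ.gnsNonUnitalStarAlgHom b (φ.toPreGNS 1 : φ.PreGNS)⟫_ℂ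
  rw [PositiveLinearMap.gnsNonUnitalStarAlgHom_apply_coe,
    UniformSpace.Completion.inner_coe, PositiveLinearMap.preGNS_inner_def]
  simp

end System

section Forms

/-! ### Closable forms -/

/-- Polarization. -/
theorem sesqForm_eq_zero_of_diag {E : Type*} [AddCommGroup E] [Module ℂ E]
    (B : E →ₗ⋆[ℂ] E →ₗ[ℂ] ℂ) (h : ∀ x, B x x = 0) : B = 0 := by
  ext x y
  have h1 := h (x + y)
  have h2 := h (x + Complex.I • y)
  simp only [map_add, LinearMap.add_apply, map_smulₛₗ, LinearMap.smul_apply, RingHom.id_apply, h,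
    smul_eq_mul, Complex.conj_I, zero_add, add_zero, mul_zero] at h1 h2
  have h3 : B y x = - B x y := by linear_combination h1
  rw [h3] at h2
  have h4 : (2 * Complex.I) * B x y = 0 := by linear_combination h2
  simpa using h4

namespace PosForm

variable {H : Type*} [NormedAddCommGroup H] [InnerProductSpace ℂ H]

theorem re_nonneg (q : PosForm H) (x : q.dom) : 0 ≤ (q.form x x).re :=
  (Complex.nonneg_iff.mp (q.nonneg x)).1

theorem form_self_eq_re (q : PosForm H) (x : q.dom) : q.form x x = ((q.form x x).re : ℂ) :=
  (Complex.ext rfl (by simpa using (Complex.nonneg_iff.mp (q.nonneg x)).2.symm))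

theorem form_self_le_form_self {q q' : PosForm H} {x : q.dom} {y : q'.dom}
    (h : (q.form x x).re ≤ (q'.form y y).re) : q.form x x ≤ q'.form y y := by
  rw [form_self_eq_re, form_self_eq_re q']
  exact Complex.real_le_real.mpr h

/-- A quantitative triangle inequality for the seminorm `q(x, x)^{1/2}`. -/
theorem re_form_le (q : PosForm H) (x y : q.dom) {t : ℝ} (ht : 0 < t) :
    (q.form x x).re ≤
      (1 + t) * (q.form (x - y) (x - y)).re + (1 + t⁻¹) * (q.form y y).re := by
  obtain ⟨u, rfl⟩ : ∃ u, x = u + y := ⟨x - y, by abel⟩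
  have h := q.re_nonneg ((t : ℂ) • u - y)
  simp only [map_sub, LinearMap.sub_apply, map_smulₛₗ, LinearMap.smul_apply,
    RingHom.id_apply, smul_eq_mul, Complex.conj_ofReal, Complex.sub_re, Complex.re_ofReal_mul] at h
  rw [add_sub_cancel_right]
  simp only [map_add, LinearMap.add_apply, Complex.add_re]
  have h2 : 0 ≤ t⁻¹ * (t * (t * (q.form u u).re) - t * (q.form y u).re -
      (t * (q.form u y).re - (q.form y y).re)) := mul_nonneg (inv_nonneg.mpr ht.le) (by linarith)
  have h3 : t⁻¹ * (t * (t * (q.form u u).re) - t * (q.form y u).re -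
      (t * (q.form u y).re - (q.form y y).re)) =
      t * (q.form u u).re - (q.form y u).re - (q.form u y).re + t⁻¹ * (q.form y y).re := by
    field_simp
    ring
  linarith

/-- A null sequence which is Cauchy for a closable form is null for this form. -/
theorem IsClosable.tendsto_zero {q : PosForm H} (hq : q.IsClosable) {x : ℕ → q.dom}
    (hx : Tendsto (fun n => (x n : H)) atTop (𝓝 0))
    (hc : ∀ ε > 0, ∃ N, ∀ m ≥ N, ∀ n ≥ N, (q.form (x m - x n) (x m - x n)).re < ε) :
    Tendsto (fun n => (q.form (x n) (x n)).re) atTop (𝓝 0) := by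
  obtain ⟨q', hq', hle, hext⟩ := hq
  have hform : ∀ z : q.dom, q'.normSqAddOne (Submodule.inclusion hle z) =
      (q.form z z).re + ‖(z : H)‖ ^ 2 := fun z => by
    rw [normSqAddOne, hext]
    rfl
  obtain ⟨y, hy⟩ := hq' (fun n => Submodule.inclusion hle (x n)) <| by
    intro ε hε
    obtain ⟨N₁, h₁⟩ := hc (ε / 2) (half_pos hε)
    have h2 : ∀ᶠ n in atTop, ‖(x n : H)‖ < √(ε / 2) / 2 := by
      have h := hx.norm
      rw [norm_zero] at h
      exact h.eventually_lt_const (by positivity)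
    obtain ⟨N₂, h₂⟩ := eventually_atTop.mp h2
    refine ⟨max N₁ N₂, fun m hm n hn => ?_⟩
    rw [← map_sub, hform]
    have h3 := h₁ m (le_of_max_le_left hm) n (le_of_max_le_left hn)
    have h4 : ‖((x m - x n : q.dom) : H)‖ < √(ε / 2) := by
      calc ‖(x m : H) - (x n : H)‖ ≤ ‖(x m : H)‖ + ‖(x n : H)‖ := norm_sub_le _ _
        _ < √(ε / 2) / 2 + √(ε / 2) / 2 :=
          add_lt_add (h₂ m (le_of_max_le_right hm)) (h₂ n (le_of_max_le_right hn))
        _ = √(ε / 2) := by ring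
    have h5 := pow_lt_pow_left₀ h4 (norm_nonneg _) two_ne_zero
    rw [Real.sq_sqrt (by positivity)] at h5
    linarith
  have hy0 : (y : H) = 0 := by
    have h1 : Tendsto (fun n => ‖(x n : H) - y‖ ^ 2) atTop (𝓝 0) :=
      squeeze_zero (fun n => by positivity)
        (fun n => le_add_of_nonneg_left (q'.re_nonneg _)) hy
    have h2 : Tendsto (fun n => ‖(x n : H) - y‖ ^ 2) atTop (𝓝 (‖0 - (y : H)‖ ^ 2)) :=
      ((hx.sub_const _).norm).pow 2
    have h3 := tendsto_nhds_unique h1 h2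
    simpa using h3.symm
  have hy1 : y = 0 := Subtype.ext hy0
  refine squeeze_zero (fun n => q.re_nonneg _) (fun n => ?_) hy
  rw [hy1, sub_zero, hform]
  exact le_add_of_nonneg_right (by positivity)

/-- A closable form which vanishes on a dense subspace is zero. -/
theorem IsClosable.eq_zero {q : PosForm H} (hq : q.IsClosable) {D : Submodule ℂ H}
    (hD : Dense (D : Set H)) (hle : D ≤ q.dom)
    (h0 : ∀ x : D, (q.form (Submodule.inclusion hle x) (Submodule.inclusion hle x)).re = 0)
    (x y : q.dom) : q.form x y = 0 := by
  rw [sesqForm_eq_zero_of_diag q.form fun x => ?_, LinearMap.zero_apply, LinearMap.zero_apply]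
  obtain ⟨z, hz, hzx⟩ := mem_closure_iff_seq_limit.mp (hD (x : H))
  let w : ℕ → D := fun n => ⟨z n, hz n⟩
  have h1 : Tendsto (fun n => (q.form (x - Submodule.inclusion hle (w n))
      (x - Submodule.inclusion hle (w n))).re) atTop (𝓝 0) := by
    refine hq.tendsto_zero ?_ fun ε hε => ⟨0, fun m _ n _ => ?_⟩
    · have h := hzx.const_sub (x : H)
      rwa [sub_self] at h
    · rw [sub_sub_sub_cancel_left, ← map_sub, h0]
      exact hε
  have h2 : (q.form x x).re ≤ 0 := by
    refine ge_of_tendsto' (by simpa using h1.const_mul 2) fun n => ?_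
    have h := q.re_form_le x (Submodule.inclusion hle (w n)) one_pos
    rw [h0] at h
    norm_num at h
    exact h
  rw [form_self_eq_re, le_antisymm h2 (q.re_nonneg x), Complex.ofReal_zero]

variable {K : Type*} [NormedAddCommGroup K] [InnerProductSpace ℂ K]

/-- The form `(x, y) ↦ ⟪T x, T y⟫` of a densely defined operator `T`. -/
def ofLinearPMap (T : H →ₗ.[ℂ] K) (hT : Dense (T.domain : Set H)) : PosForm H where
  dom := T.domain
  dense := hT
  form := ((innerₛₗ ℂ).comp T.toFun).compl₂ T.toFun
  nonneg x := by
    change (0 : ℂ) ≤ ⟪T x, T x⟫_ℂ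
    rw [inner_self_eq_norm_sq_to_K]
    exact pow_nonneg (Complex.zero_le_real.mpr (norm_nonneg (T x))) 2

theorem normSqAddOne_ofLinearPMap (T : H →ₗ.[ℂ] K) (hT : Dense (T.domain : Set H))
    (x : T.domain) : (ofLinearPMap T hT).normSqAddOne x = ‖T x‖ ^ 2 + ‖(x : H)‖ ^ 2 := by
  change (⟪T x, T x⟫_ℂ).re + ‖(x : H)‖ ^ 2 = _
  congr 1
  exact inner_self_eq_norm_sq (𝕜 := ℂ) _

/-- The form of a closed operator is closed. -/
theorem isClosed_ofLinearPMap [CompleteSpace H] [CompleteSpace K] {T : H →ₗ.[ℂ] K}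
    (hT : Dense (T.domain : Set H)) (hcl : T.IsClosed) : (ofLinearPMap T hT).IsClosed := by
  intro x hx
  obtain ⟨x, rfl⟩ : ∃ x' : ℕ → T.domain, x' = x := ⟨x, rfl⟩
  have key : ∀ z : T.domain, ∀ ε > 0, (ofLinearPMap T hT).normSqAddOne z < ε ^ 2 →
      ‖(z : H)‖ < ε ∧ ‖T z‖ < ε := by
    intro z ε hε h
    rw [normSqAddOne_ofLinearPMap] at h
    exact ⟨lt_of_pow_lt_pow_left₀ 2 hε.le (by linarith [sq_nonneg ‖T z‖]),
      lt_of_pow_lt_pow_left₀ 2 hε.le (by linarith [sq_nonneg ‖(z : H)‖])⟩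
  have hc1 : CauchySeq fun n => (x n : H) := Metric.cauchySeq_iff.mpr fun ε hε => by
    obtain ⟨N, hN⟩ := hx (ε ^ 2) (by positivity)
    refine ⟨N, fun m hm n hn => ?_⟩
    rw [dist_eq_norm]
    exact (key _ ε hε (hN m hm n hn)).1
  have hc2 : CauchySeq fun n => T (x n) := Metric.cauchySeq_iff.mpr fun ε hε => by
    obtain ⟨N, hN⟩ := hx (ε ^ 2) (by positivity)
    refine ⟨N, fun m hm n hn => ?_⟩
    rw [dist_eq_norm, ← T.map_sub]
    exact (key _ ε hε (hN m hm n hn)).2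
  obtain ⟨y, hy⟩ := cauchySeq_tendsto_of_complete hc1
  obtain ⟨k, hk⟩ := cauchySeq_tendsto_of_complete hc2
  have hmem : (y, k) ∈ T.graph := hcl.mem_of_tendsto (hy.prodMk_nhds hk)
    (Eventually.of_forall fun n => T.mem_graph (x n))
  obtain ⟨y', hy', hk'⟩ := T.mem_graph_iff.mp hmem
  simp only at hy' hk'
  refine ⟨y', ?_⟩
  have h1 : Tendsto (fun n => ‖T (x n) - k‖ ^ 2 + ‖(x n : H) - y‖ ^ 2) atTop
      (𝓝 (‖k - k‖ ^ 2 + ‖y - y‖ ^ 2)) :=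
    ((hk.sub_const _).norm.pow 2).add ((hy.sub_const _).norm.pow 2)
  simp only [sub_self, norm_zero, ne_eq, OfNat.ofNat_ne_zero, not_false_eq_true, zero_pow,
    add_zero] at h1
  refine h1.congr fun n => ?_
  rw [← hy', ← hk', ← T.map_sub, ← Submodule.coe_sub]
  exact (normSqAddOne_ofLinearPMap T hT (x n - y')).symm

end PosForm

end Forms

section Representations

variable {d : ℕ} {K : Type*} [NormedAddCommGroup K] [InnerProductSpace ℂ K] [CompleteSpace K]

/-! ### NC measures given by vectors of a representation -/

theorem inner_map_star_mul {A : Type*} [CStarAlgebra A] (π : A →⋆ₐ[ℂ] (K →L[ℂ] K)) (ξ η : K)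
    (a b : A) : ⟪ξ, π (star a * b) η⟫_ℂ = ⟪π a ξ, π b η⟫_ℂ := by
  rw [map_mul, map_star, ContinuousLinearMap.star_eq_adjoint, mul_apply_eq_comp,
    ContinuousLinearMap.adjoint_inner_right]

theorem inner_map_star_mul_self {A : Type*} [CStarAlgebra A] (π : A →⋆ₐ[ℂ] (K →L[ℂ] K)) (ξ : K)
    (a : A) : ⟪ξ, π (star a * a) ξ⟫_ℂ = ((‖π a ξ‖ ^ 2 : ℝ) : ℂ) := by
  rw [inner_map_star_mul, inner_self_eq_norm_sq_to_K]
  push_cast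
  rfl

/-- Stated over an abstract C⋆-algebra: on the bounded operators on the Fock space the two
`ℝ`-module structures are not unified by instance search. -/
theorem exists_eq_star_mul_self {A : Type*} [CStarAlgebra A] [PartialOrder A] [StarOrderedRing A]
    {s : A} (hs : 0 ≤ s) : ∃ t, s = star t * t :=
  CStarAlgebra.nonneg_iff_eq_star_mul_self.mp hs

/-- The NC measure `s ↦ ⟪ξ, π s ξ⟫` of a vector `ξ` in a representation `π` of the bounded
operators on the Fock space. -/
def vectorMeasure (π : (Fock d →L[ℂ] Fock d) →⋆ₐ[ℂ] (K →L[ℂ] K)) (ξ : K) : NCMeasure d where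
  toFun :=
    { toFun := fun s => ⟪ξ, π s ξ⟫_ℂ
      map_add' := fun s t => by
        rw [Submodule.coe_add, map_add, add_apply, inner_add_right]
      map_smul' := fun c s => by
        rw [Submodule.coe_smul, map_smul, smul_apply, inner_smul_right, RingHom.id_apply,
          smul_eq_mul] }
  nonneg s hs := by
    obtain ⟨t, ht⟩ := exists_eq_star_mul_self
      ((ContinuousLinearMap.nonneg_iff_isPositive _).mpr hs)
    change 0 ≤ ⟪ξ, π s ξ⟫_ℂ
    rw [ht, inner_map_star_mul_self]
    exact Complex.zero_le_real.mpr (sq_nonneg _)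

variable (π : (Fock d →L[ℂ] Fock d) →⋆ₐ[ℂ] (K →L[ℂ] K)) (ξ : K)

theorem vectorMeasure_apply (s : freeDiskSystem d) :
    (vectorMeasure π ξ).toFun s = ⟪ξ, π s ξ⟫_ℂ := rfl

theorem quadForm_vectorMeasure (a b : (freeDiskAlgebra d).toSubmodule) :
    (vectorMeasure π ξ).quadForm.form (diskEquiv d a) (diskEquiv d b) = ⟪π a ξ, π b ξ⟫_ℂ := by
  rw [NCMeasure.quadForm_apply, vectorMeasure_apply]
  exact inner_map_star_mul π ξ ξ _ _

theorem re_quadForm_vectorMeasure (a : (freeDiskAlgebra d).toSubmodule) :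
    ((vectorMeasure π ξ).quadForm.form (diskEquiv d a) (diskEquiv d a)).re = ‖π a ξ‖ ^ 2 := by
  rw [quadForm_vectorMeasure]
  exact inner_self_eq_norm_sq (𝕜 := ℂ) _

theorem NCMeasure.exists_eq_vectorMeasure (μ : NCMeasure d) :
    ∃ (K : Type) (_ : NormedAddCommGroup K) (_ : InnerProductSpace ℂ K) (_ : CompleteSpace K)
      (π : (Fock d →L[ℂ] Fock d) →⋆ₐ[ℂ] (K →L[ℂ] K)) (ξ : K), μ = vectorMeasure π ξ := by
  obtain ⟨φ, hφ⟩ := μ.exists_positive_extension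
  obtain ⟨K, _, _, _, π, ξ, h⟩ := exists_representation φ
  exact ⟨K, _, _, _, π, ξ, NCMeasure.ext (LinearMap.ext fun s =>
    (hφ s).symm.trans (h s))⟩

/-- An NC measure is determined by its values on the squares `a^* a`, hence by its form. -/
theorem NCMeasure.ext_of_quadForm {μ ν : NCMeasure d}
    (h : ∀ a : (freeDiskAlgebra d).toSubmodule, μ.quadForm.form (diskEquiv d a) (diskEquiv d a) =
      ν.quadForm.form (diskEquiv d a) (diskEquiv d a)) : μ = ν := by
  obtain ⟨φ, hφ⟩ := μ.exists_positive_extension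
  obtain ⟨ψ, hψ⟩ := ν.exists_positive_extension
  have hpre : μ.preForm - ν.preForm = 0 := sesqForm_eq_zero_of_diag _ fun a => by
    have ha := h a
    rw [quadForm_apply, quadForm_apply] at ha
    exact sub_eq_zero.mpr ha
  have hmul : ∀ a ∈ freeDiskAlgebra d, ∀ b ∈ freeDiskAlgebra d,
      φ (star a * b) = ψ (star a * b) := fun a ha b hb => by
    have h1 := LinearMap.congr_fun (LinearMap.congr_fun hpre ⟨a, ha⟩) ⟨b, hb⟩
    exact (hφ ⟨_, star_mul_mem_freeDiskSystem ha hb⟩).trans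
      ((sub_eq_zero.mp h1).trans (hψ ⟨_, star_mul_mem_freeDiskSystem ha hb⟩).symm)
  refine NCMeasure.ext (LinearMap.ext fun s => ?_)
  rw [← hφ, ← hψ]
  refine freeDiskSystem_induction (p := fun s => φ s = ψ s)
    (isClosed_eq (map_continuous φ) (map_continuous ψ)) ?_ ?_ ?_ s.2
  · intro s t hs ht
    rw [map_add, map_add, hs, ht]
  · intro a ha
    simpa using hmul 1 (one_mem _) a ha
  · intro a ha
    simpa using hmul a ha 1 (one_mem _)

/-! ### The backward shifts -/

theorem inner_vacuum_leftShift (k : Fin d) (x : Fock d) : ⟪vacuum d, leftShift d k x⟫_ℂ = 0 := by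
  rw [vacuum, basisVec, lp.inner_single_left]
  have h : leftShift d k x 1 = 0 := wordIsometry_apply' (mul_right_injective _) _ <| by
    rintro ⟨v, hv⟩
    exact absurd (congrArg FreeMonoid.toList hv) (by simp)
  rw [h, inner_zero_right]

theorem inner_vacuum_self : ⟪vacuum d, vacuum d⟫_ℂ = 1 := by
  rw [vacuum, basisVec, lp.inner_single_left]
  simp

/-- Removing the constant term of `a ∈ 𝒜_d` and then a first letter `k` from all its words leads
back into `𝒜_d`. -/
theorem star_leftShift_mul_sub_mem (k : Fin d) {a : Fock d →L[ℂ] Fock d}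
    (ha : a ∈ freeDiskAlgebra d) :
    star (leftShift d k) * (a - ⟪vacuum d, a (vacuum d)⟫_ℂ • 1) ∈ freeDiskAlgebra d := by
  have hcl : IsClosed {a : Fock d →L[ℂ] Fock d |
      star (leftShift d k) * (a - ⟪vacuum d, a (vacuum d)⟫_ℂ • 1) ∈ freeDiskAlgebra d} := by
    refine IsClosed.preimage (f := fun a : Fock d →L[ℂ] Fock d =>
      star (leftShift d k) * (a - ⟪vacuum d, a (vacuum d)⟫_ℂ • 1)) ?_
      (Subalgebra.isClosed_topologicalClosure (Algebra.adjoin ℂ (Set.range (leftShift d))))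
    fun_prop
  refine closure_minimal (fun x hx => ?_) hcl ha
  have hx' : x ∈ Submodule.span ℂ (Set.range (monomial d)) := by
    rw [← adjoin_eq_span_monomial]
    exact hx
  clear hx
  change star (leftShift d k) * (x - ⟪vacuum d, x (vacuum d)⟫_ℂ • 1) ∈ freeDiskAlgebra d
  induction hx' using Submodule.span_induction with
  | mem x hx =>
    obtain ⟨α, rfl⟩ := hx
    cases α with
    | nil =>
      have h : monomial d [] = 1 := rfl
      rw [h, one_apply_eq_self, inner_vacuum_self, one_smul, sub_self, mul_zero]
      exact zero_mem _
    | cons j α =>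
      have h : monomial d (j :: α) = leftShift d j * monomial d α := rfl
      rw [h, mul_apply_eq_comp, inner_vacuum_leftShift, zero_smul, sub_zero, ← mul_assoc]
      by_cases hjk : k = j
      · rw [hjk, star_leftShift_mul_self, one_mul]
        exact Subalgebra.le_topologicalClosure _ (monomial_mem_adjoin α)
      · rw [star_leftShift_mul_of_ne hjk, zero_mul]
        exact zero_mem _
  | zero => simp
  | add x y _ _ hx hy =>
    convert add_mem hx hy using 1
    rw [add_apply, inner_add_right, add_smul, ← mul_add]
    congr 1
    abel
  | smul c x _ hx =>
    convert Subalgebra.smul_mem _ hx c using 1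
    rw [smul_apply, inner_smul_right, mul_smul, ← smul_sub, mul_smul_comm]

end Representations

section Decomposition

variable {d : ℕ} {K : Type*} [NormedAddCommGroup K] [InnerProductSpace ℂ K] [CompleteSpace K]
  (π : (Fock d →L[ℂ] Fock d) →⋆ₐ[ℂ] (K →L[ℂ] K)) (ξ : K)

/-! ### The singular subspace reduces the shifts -/

/-- The linear map `a ↦ (a 1, π a ξ)` on the free disk algebra. Its range is the graph of the
densely defined operator `a 1 ↦ π a ξ`. -/
def orbitMap : (freeDiskAlgebra d).toSubmodule →ₗ[ℂ] Fock d × K :=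
  (evalVacuum d).prod
    { toFun := fun a => π a ξ
      map_add' := fun a b => by rw [Submodule.coe_add, map_add, add_apply]
      map_smul' := fun c a => by
        rw [Submodule.coe_smul, map_smul, smul_apply, RingHom.id_apply] }

/-- The closure in `H × K` of the graph of `a 1 ↦ π a ξ`; it need not be a graph. -/
def orbitGraph : Submodule ℂ (Fock d × K) := (LinearMap.range (orbitMap π ξ)).topologicalClosure

/-- The multivalued part `{k | (0, k) ∈ G}` of the closed graph `G` of `a 1 ↦ π a ξ`, the
obstruction to closability of `(a, b) ↦ ⟪π a ξ, π b ξ⟫`. -/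
def singularSubspace : Submodule ℂ K := (orbitGraph π ξ).comap (LinearMap.inr ℂ (Fock d) K)

variable {π ξ}

theorem orbitMap_mem_orbitGraph (a : (freeDiskAlgebra d).toSubmodule) :
    (evalVacuum d a, π a ξ) ∈ orbitGraph π ξ :=
  Submodule.le_topologicalClosure _ ⟨a, rfl⟩

theorem mem_singularSubspace {k : K} : k ∈ singularSubspace π ξ ↔ (0, k) ∈ orbitGraph π ξ :=
  Iff.rfl

/-- The elements of the singular subspace are the limits of `π (a n) ξ` along the sequences for
which `a n 1` tends to `0`. -/
theorem mem_singularSubspace_iff_seq {k : K} :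
    k ∈ singularSubspace π ξ ↔ ∃ a : ℕ → (freeDiskAlgebra d).toSubmodule,
      Tendsto (fun n => evalVacuum d (a n)) atTop (𝓝 0) ∧
      Tendsto (fun n => π (a n) ξ) atTop (𝓝 k) := by
  rw [mem_singularSubspace]
  constructor
  · intro h
    obtain ⟨z, hz, hlim⟩ := mem_closure_iff_seq_limit.mp h
    choose a ha using hz
    have hlim' : Tendsto (fun n => orbitMap π ξ (a n)) atTop (𝓝 (0, k)) := by
      simpa only [ha] using hlim
    exact ⟨a, (continuous_fst.tendsto _).comp hlim', (continuous_snd.tendsto _).comp hlim'⟩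
  · rintro ⟨a, h1, h2⟩
    exact mem_closure_of_tendsto (h1.prodMk_nhds h2)
      (Eventually.of_forall fun n => ⟨a n, rfl⟩)

theorem isClosed_singularSubspace : IsClosed (singularSubspace π ξ : Set K) :=
  (Submodule.isClosed_topologicalClosure (LinearMap.range (orbitMap π ξ))).preimage
    (Continuous.prodMk_right (0 : Fock d))

instance : CompleteSpace (singularSubspace π ξ) := isClosed_singularSubspace.completeSpace_coe

theorem map_mem_singularSubspace {a : Fock d →L[ℂ] Fock d} (ha : a ∈ freeDiskAlgebra d) {k : K}
    (hk : k ∈ singularSubspace π ξ) : π a k ∈ singularSubspace π ξ := by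
  have h := map_mem_closure (f := fun z : Fock d × K => (a z.1, π a z.2))
    (t := LinearMap.range (orbitMap π ξ)) (by fun_prop) (mem_singularSubspace.mp hk) (by
      rintro _ ⟨b, rfl⟩
      refine ⟨⟨a * b, (freeDiskAlgebra d).mul_mem ha b.2⟩, Prod.ext rfl ?_⟩
      change π (a * b) ξ = π a (π b ξ)
      rw [map_mul, mul_apply_eq_comp])
  rw [map_zero] at h
  exact h

theorem map_star_leftShift_mem_singularSubspace (j : Fin d) {k : K}
    (hk : k ∈ singularSubspace π ξ) : π (star (leftShift d j)) k ∈ singularSubspace π ξ := by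
  -- The constant term `⟪1, x⟫` is continuous in `x`, so that the backward shift with the constant
  -- term removed acts on the closed graph; over `0` it is `π (L_j^*)`.
  have h := map_mem_closure (f := fun z : Fock d × K =>
      (star (leftShift d j) (z.1 - ⟪vacuum d, z.1⟫_ℂ • vacuum d),
        π (star (leftShift d j)) (z.2 - ⟪vacuum d, z.1⟫_ℂ • ξ)))
    (t := LinearMap.range (orbitMap π ξ)) (by fun_prop) (mem_singularSubspace.mp hk) (by
      rintro _ ⟨b, rfl⟩
      refine ⟨⟨_, star_leftShift_mul_sub_mem j b.2⟩, Prod.ext rfl ?_⟩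
      change π (star (leftShift d j) *
        ((b : Fock d →L[ℂ] Fock d) - ⟪vacuum d, (b : Fock d →L[ℂ] Fock d) (vacuum d)⟫_ℂ • 1)) ξ =
        π (star (leftShift d j))
          (π b ξ - ⟪vacuum d, (b : Fock d →L[ℂ] Fock d) (vacuum d)⟫_ℂ • ξ)
      rw [map_mul, mul_apply_eq_comp, map_sub, map_smul, map_one, sub_apply, smul_apply,
        one_apply_eq_self])
  simp only [inner_zero_right, zero_smul, sub_zero, map_zero] at h
  exact h

theorem map_mem_orthogonal_singularSubspace {a : Fock d →L[ℂ] Fock d}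
    (ha : a ∈ freeDiskAlgebra d) {h : K} (hh : h ∈ (singularSubspace π ξ)ᗮ) :
    π a h ∈ (singularSubspace π ξ)ᗮ := by
  have hcont : Continuous fun b : Fock d →L[ℂ] Fock d => π b :=
    map_continuous π
  refine closure_minimal (s := Algebra.adjoin ℂ (Set.range (leftShift d)))
    (t := {b : Fock d →L[ℂ] Fock d | ∀ h ∈ (singularSubspace π ξ)ᗮ, π b h ∈ (singularSubspace π ξ)ᗮ})
    (fun b hb => ?_) ?_ ha h hh
  · induction hb using Algebra.adjoin_induction with
    | mem x hx =>
      obtain ⟨j, rfl⟩ := hx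
      intro h hh
      refine (Submodule.mem_orthogonal _ _).mpr fun k hk => ?_
      have h1 := (Submodule.mem_orthogonal _ _).mp hh _
        (map_star_leftShift_mem_singularSubspace j hk)
      rwa [map_star, ContinuousLinearMap.star_eq_adjoint,
        ContinuousLinearMap.adjoint_inner_left] at h1
    | algebraMap r =>
      intro h hh
      rw [Algebra.algebraMap_eq_smul_one, map_smul, map_one]
      exact Submodule.smul_mem _ r hh
    | add x y _ _ hx hy =>
      intro h hh
      rw [map_add]
      exact add_mem (hx h hh) (hy h hh)
    | mul x y _ _ hx hy =>
      intro h hh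
      rw [map_mul]
      exact hx _ (hy h hh)
  · simp only [Set.ofPred_forall]
    refine isClosed_biInter fun h _ => ?_
    exact (Submodule.isClosed_orthogonal _).preimage (hcont.clm_apply continuous_const)

/-! ### Regular and singular parts -/

variable (π ξ)

/-- The component of `ξ` in the singular subspace. -/
def singularVector : K := (singularSubspace π ξ).starProjection ξ

/-- The component of `ξ` orthogonal to the singular subspace. -/
def regularVector : K := ξ - singularVector π ξ

variable {π ξ}

theorem map_singularVector_mem {a : Fock d →L[ℂ] Fock d} (ha : a ∈ freeDiskAlgebra d) :
    π a (singularVector π ξ) ∈ singularSubspace π ξ :=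
  map_mem_singularSubspace ha (Submodule.starProjection_apply_mem _ _)

theorem map_regularVector_mem {a : Fock d →L[ℂ] Fock d} (ha : a ∈ freeDiskAlgebra d) :
    π a (regularVector π ξ) ∈ (singularSubspace π ξ)ᗮ :=
  map_mem_orthogonal_singularSubspace ha (Submodule.sub_starProjection_mem_orthogonal _)

theorem map_eq_add (a : Fock d →L[ℂ] Fock d) :
    π a ξ = π a (singularVector π ξ) + π a (regularVector π ξ) := by
  rw [← map_add, regularVector, add_sub_cancel]

theorem starProjection_map {a : Fock d →L[ℂ] Fock d} (ha : a ∈ freeDiskAlgebra d) :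
    (singularSubspace π ξ).starProjection (π a ξ) = π a (singularVector π ξ) :=
  Submodule.eq_starProjection_of_mem_orthogonal' (map_singularVector_mem ha)
    (map_regularVector_mem ha) (map_eq_add a)

theorem vectorMeasure_eq_add :
    vectorMeasure π ξ =
      vectorMeasure π (regularVector π ξ) + vectorMeasure π (singularVector π ξ) := by
  refine NCMeasure.ext_of_quadForm fun a => ?_
  have hadd : (vectorMeasure π (regularVector π ξ) +
      vectorMeasure π (singularVector π ξ)).quadForm.form (diskEquiv d a) (diskEquiv d a) =
      (vectorMeasure π (regularVector π ξ)).quadForm.form (diskEquiv d a) (diskEquiv d a) +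
      (vectorMeasure π (singularVector π ξ)).quadForm.form (diskEquiv d a) (diskEquiv d a) := rfl
  have h0 : ⟪π a (singularVector π ξ), π a (regularVector π ξ)⟫_ℂ = 0 :=
    (map_regularVector_mem a.2) _ (map_singularVector_mem a.2)
  have h1 : ⟪π a (regularVector π ξ), π a (singularVector π ξ)⟫_ℂ = 0 :=
    inner_eq_zero_symm.mp h0
  rw [hadd, quadForm_vectorMeasure, quadForm_vectorMeasure, quadForm_vectorMeasure, map_eq_add,
    inner_add_left, inner_add_right, inner_add_right, h0, h1, add_zero, zero_add, add_comm]

theorem vectorMeasure_regularVector_le :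
    vectorMeasure π (regularVector π ξ) ≤ vectorMeasure π ξ := by
  rw [vectorMeasure_eq_add (ξ := ξ)]
  exact fun s hs => le_add_of_nonneg_right ((vectorMeasure π _).nonneg s hs)

/-- The closure of `a 1 ↦ π a η`, for the regular vector `η`, is the operator whose graph consists
of the elements of `orbitGraph` with second component orthogonal to the singular subspace. -/
theorem isAC_vectorMeasure_regularVector : (vectorMeasure π (regularVector π ξ)).IsAC := by
  set M := singularSubspace π ξ with hM
  let g : Submodule ℂ (Fock d × K) := orbitGraph π ξ ⊓ Mᗮ.comap (LinearMap.snd ℂ (Fock d) K)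
  have hg : ∀ x ∈ g, x.1 = 0 → x.2 = 0 := by
    rintro ⟨x, k⟩ hx rfl
    have hk := hx.2 k (mem_singularSubspace.mpr hx.1)
    exact inner_self_eq_zero.mp hk
  have hgraph : g.toLinearPMap.graph = g := g.toLinearPMap_graph_eq hg
  have hmem : ∀ a : (freeDiskAlgebra d).toSubmodule,
      (evalVacuum d a, π a (regularVector π ξ)) ∈ g := by
    intro a
    refine ⟨?_, map_regularVector_mem a.2⟩
    have h := sub_mem (orbitMap_mem_orbitGraph (π := π) (ξ := ξ) a)
      (mem_singularSubspace.mp (map_singularVector_mem (π := π) (ξ := ξ) a.2))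
    rwa [map_eq_add, Prod.mk_sub_mk, sub_zero, add_sub_cancel_left] at h
  have hle : LinearMap.range (evalVacuum d) ≤ g.toLinearPMap.domain := by
    rintro _ ⟨a, rfl⟩
    exact ⟨_, hmem a, rfl⟩
  have hdense : Dense (g.toLinearPMap.domain : Set (Fock d)) :=
    (dense_range_evalVacuum d).mono hle
  have hcl : g.toLinearPMap.IsClosed := by
    rw [LinearPMap.IsClosed, hgraph]
    exact (Submodule.isClosed_topologicalClosure (LinearMap.range (orbitMap π ξ))).inter
      ((Submodule.isClosed_orthogonal M).preimage continuous_snd)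
  have hval : ∀ a : (freeDiskAlgebra d).toSubmodule,
      g.toLinearPMap (Submodule.inclusion hle (diskEquiv d a)) = π a (regularVector π ξ) := by
    intro a
    refine g.toLinearPMap.mem_graph_snd_inj (g.toLinearPMap.mem_graph _) ?_ rfl
    rw [hgraph]
    exact hmem a
  refine ⟨PosForm.ofLinearPMap _ hdense, PosForm.isClosed_ofLinearPMap hdense hcl, hle,
    fun x y => ?_⟩
  obtain ⟨a, rfl⟩ := (diskEquiv d).surjective x
  obtain ⟨b, rfl⟩ := (diskEquiv d).surjective y
  rw [quadForm_vectorMeasure, ← hval, ← hval]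
  rfl

/-- If `b n 1 → 0` and `π (b n) ω → k`, then `q(b n, b n) → 0` by closability, and the bound at
`a - b n` becomes a bound at `a` in the limit. -/
theorem re_form_le_norm_sub_sq {ω k : K} (hk : k ∈ singularSubspace π ω) {q : PosForm (Fock d)}
    (hq : q.IsClosable) (hle : LinearMap.range (evalVacuum d) ≤ q.dom)
    (hbound : ∀ a : (freeDiskAlgebra d).toSubmodule,
      (q.form (Submodule.inclusion hle (diskEquiv d a))
        (Submodule.inclusion hle (diskEquiv d a))).re ≤ ‖π a ω‖ ^ 2)
    (a : (freeDiskAlgebra d).toSubmodule) :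
    (q.form (Submodule.inclusion hle (diskEquiv d a))
      (Submodule.inclusion hle (diskEquiv d a))).re ≤ ‖π a ω - k‖ ^ 2 := by
  obtain ⟨b, hb0, hbk⟩ := mem_singularSubspace_iff_seq.mp hk
  let x : (freeDiskAlgebra d).toSubmodule → q.dom :=
    fun a => Submodule.inclusion hle (diskEquiv d a)
  have hxsub : ∀ a b, x (a - b) = x a - x b := fun a b =>
    (congrArg (Submodule.inclusion hle) ((diskEquiv d).toLinearMap.map_sub a b)).trans
      ((Submodule.inclusion hle).map_sub _ _)
  have hsub : ∀ a b : (freeDiskAlgebra d).toSubmodule,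
      (q.form (x a - x b) (x a - x b)).re ≤ ‖π a ω - π b ω‖ ^ 2 := fun a b => by
    rw [← hxsub]
    refine (hbound _).trans_eq ?_
    rw [Submodule.coe_sub, map_sub, sub_apply]
  have hnull : Tendsto (fun n => (q.form (x (b n)) (x (b n))).re) atTop (𝓝 0) := by
    refine hq.tendsto_zero hb0 fun ε hε => ?_
    obtain ⟨N, hN⟩ := Metric.cauchySeq_iff.mp hbk.cauchySeq (√ε) (Real.sqrt_pos.mpr hε)
    refine ⟨N, fun m hm n hn => (hsub _ _).trans_lt ?_⟩
    have h := hN m hm n hn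
    rw [dist_eq_norm] at h
    calc _ < √ε ^ 2 := pow_lt_pow_left₀ h (norm_nonneg _) two_ne_zero
      _ = ε := Real.sq_sqrt hε.le
  have ht : ∀ t : ℝ, 0 < t → (q.form (x a) (x a)).re ≤ (1 + t) * ‖π a ω - k‖ ^ 2 := by
    intro t ht
    have hlim : Tendsto (fun n => (1 + t) * ‖π a ω - π (b n) ω‖ ^ 2 +
        (1 + t⁻¹) * (q.form (x (b n)) (x (b n))).re) atTop
        (𝓝 ((1 + t) * ‖π a ω - k‖ ^ 2 + (1 + t⁻¹) * 0)) :=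
      (((hbk.const_sub _).norm.pow 2).const_mul _).add (hnull.const_mul _)
    rw [mul_zero, add_zero] at hlim
    refine ge_of_tendsto' hlim fun n => (q.re_form_le _ (x (b n)) ht).trans ?_
    gcongr
    exact hsub _ _
  have hlim : Tendsto (fun t : ℝ => (1 + t) * ‖π a ω - k‖ ^ 2) (𝓝[>] 0)
      (𝓝 ((1 + 0) * ‖π a ω - k‖ ^ 2)) :=
    ((continuous_const.add continuous_id).mul continuous_const).continuousWithinAt
  rw [add_zero, one_mul] at hlim
  exact ge_of_tendsto hlim (eventually_mem_nhdsWithin.mono fun t h => ht t h)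

theorem re_form_le_of_le_quadForm {ω : K} {q : PosForm (Fock d)}
    (h : q ≤ (vectorMeasure π ω).quadForm) :
    ∃ hle : LinearMap.range (evalVacuum d) ≤ q.dom, ∀ a : (freeDiskAlgebra d).toSubmodule,
      (q.form (Submodule.inclusion hle (diskEquiv d a))
        (Submodule.inclusion hle (diskEquiv d a))).re ≤ ‖π a ω‖ ^ 2 := by
  obtain ⟨hle, hq⟩ := h
  refine ⟨hle, fun a => ?_⟩
  rw [← re_quadForm_vectorMeasure]
  exact (Complex.le_def.mp (hq (diskEquiv d a))).1

theorem le_quadForm_regularVector {q : PosForm (Fock d)} (hq : q.IsClosable)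
    (h : q ≤ (vectorMeasure π ξ).quadForm) :
    q ≤ (vectorMeasure π (regularVector π ξ)).quadForm := by
  obtain ⟨hle, hbound⟩ := re_form_le_of_le_quadForm h
  refine ⟨hle, fun x => ?_⟩
  obtain ⟨a, rfl⟩ := (diskEquiv d).surjective x
  refine PosForm.form_self_le_form_self ?_
  have h1 := re_form_le_norm_sub_sq (map_singularVector_mem (π := π) (ξ := ξ) a.2) hq hle hbound a
  rw [map_eq_add, add_sub_cancel_left] at h1
  exact h1.trans_eq (re_quadForm_vectorMeasure π _ a).symm

theorem isSingular_vectorMeasure_singularVector :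
    (vectorMeasure π (singularVector π ξ)).IsSingular := by
  intro q hq h
  obtain ⟨hle, hbound⟩ := re_form_le_of_le_quadForm h
  refine hq.eq_zero (dense_range_evalVacuum d) hle fun x => ?_
  obtain ⟨a, rfl⟩ := (diskEquiv d).surjective x
  -- Projecting a sequence `π (b n) ξ` onto the singular subspace shows that `π a ζ`, for the
  -- singular vector `ζ`, is singular for `ζ` as well.
  have hmem : π a (singularVector π ξ) ∈ singularSubspace π (singularVector π ξ) := by
    obtain ⟨b, hb0, hb⟩ :=
      mem_singularSubspace_iff_seq.mp (map_singularVector_mem (π := π) (ξ := ξ) a.2)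
    refine mem_singularSubspace_iff_seq.mpr ⟨b, hb0, ?_⟩
    have h1 := (((singularSubspace π ξ).starProjection.continuous.tendsto _).comp hb)
    rw [Submodule.starProjection_eq_self_iff.mpr (map_singularVector_mem a.2)] at h1
    exact h1.congr fun n => starProjection_map (b n).2
  have h1 := re_form_le_norm_sub_sq hmem hq hle hbound a
  rw [sub_self, norm_zero, zero_pow two_ne_zero] at h1
  exact le_antisymm h1 (q.re_nonneg _)

/-! ### Maximality among absolutely continuous NC measures -/

/-- Let `ν` be absolutely continuous and dominated by `ξ` on all operators, and let `π (b n) ξ` tend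
to the singular vector with `b n 1 → 0`. Then `t - t (b n)` tends to `t` for `ν`, while its image
of `ξ` tends to the image `π t η` of the regular vector `η`. -/
theorem vectorMeasure_le_regularVector {K' : Type*} [NormedAddCommGroup K']
    [InnerProductSpace ℂ K'] [CompleteSpace K']
    {π' : (Fock d →L[ℂ] Fock d) →⋆ₐ[ℂ] (K' →L[ℂ] K')} {ξ' : K'}
    (hdom : ∀ b, ‖π' b ξ'‖ ≤ ‖π b ξ‖) (hac : (vectorMeasure π' ξ').IsAC) :
    vectorMeasure π' ξ' ≤ vectorMeasure π (regularVector π ξ) := by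
  obtain ⟨b, hb0, hb⟩ := mem_singularSubspace_iff_seq.mp
    (Submodule.starProjection_apply_mem (singularSubspace π ξ) ξ)
  have hnull : Tendsto (fun n => ‖π' (b n) ξ'‖ ^ 2) atTop (𝓝 0) := by
    have h := hac.tendsto_zero (x := fun n => diskEquiv d (b n)) hb0 fun ε hε => ?_
    · exact h.congr fun n => re_quadForm_vectorMeasure π' ξ' (b n)
    · obtain ⟨N, hN⟩ := Metric.cauchySeq_iff.mp hb.cauchySeq (√ε) (Real.sqrt_pos.mpr hε)
      refine ⟨N, fun m hm n hn => ?_⟩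
      have h1 := hN m hm n hn
      rw [dist_eq_norm, ← sub_apply, ← map_sub] at h1
      have h2 : diskEquiv d (b m) - diskEquiv d (b n) = diskEquiv d (b m - b n) :=
        ((diskEquiv d).toLinearMap.map_sub _ _).symm
      have h3 := congrArg (fun x : (vectorMeasure π' ξ').quadForm.dom =>
        ((vectorMeasure π' ξ').quadForm.form x x).re) h2
      refine (h3.trans (re_quadForm_vectorMeasure π' ξ' (b m - b n))).trans_lt ?_
      calc _ < √ε ^ 2 := pow_lt_pow_left₀ ((hdom _).trans_lt h1) (norm_nonneg _) two_ne_zero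
        _ = ε := Real.sq_sqrt hε.le
  have hnull' : Tendsto (fun n => π' (b n) ξ') atTop (𝓝 0) := by
    rw [tendsto_zero_iff_norm_tendsto_zero]
    have h := hnull.sqrt
    simpa only [Real.sqrt_sq (norm_nonneg _), Real.sqrt_zero] using h
  have key : ∀ t, ‖π' t ξ'‖ ≤ ‖π t (regularVector π ξ)‖ := by
    intro t
    have h1 : Tendsto (fun n => ‖π' t (ξ' - π' (b n) ξ')‖) atTop (𝓝 ‖π' t (ξ' - 0)‖) :=
      (((π' t).continuous.tendsto _).comp (hnull'.const_sub ξ')).norm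
    have h2 : Tendsto (fun n => ‖π t (ξ - π (b n) ξ)‖) atTop (𝓝 ‖π t (regularVector π ξ)‖) :=
      (((π t).continuous.tendsto _).comp (hb.const_sub ξ)).norm
    rw [sub_zero] at h1
    refine le_of_tendsto_of_tendsto' h1 h2 fun n => ?_
    have h := hdom (t * (1 - b n))
    simpa only [map_mul, map_sub, map_one, mul_apply_eq_comp, sub_apply, one_apply_eq_self] using h
  intro s hs
  obtain ⟨t, ht⟩ := exists_eq_star_mul_self
    ((ContinuousLinearMap.nonneg_iff_isPositive _).mpr hs)
  rw [vectorMeasure_apply, vectorMeasure_apply, ht, inner_map_star_mul_self,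
    inner_map_star_mul_self]
  exact Complex.real_le_real.mpr (pow_le_pow_left₀ (norm_nonneg _) (key t) 2)

namespace NCMeasure

protected theorem le_self_add (μ ν : NCMeasure d) : μ ≤ μ + ν := fun s hs =>
  le_add_of_nonneg_right (ν.nonneg s hs)

protected theorem le_add_self (μ ν : NCMeasure d) : ν ≤ μ + ν := fun s hs =>
  le_add_of_nonneg_left (μ.nonneg s hs)

protected theorem add_left_cancel {μ ν ρ : NCMeasure d} (h : μ + ν = μ + ρ) : ν = ρ :=
  NCMeasure.ext (add_left_cancel (a := μ.toFun) (congrArg NCMeasure.toFun h))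

theorem quadForm_le_quadForm {μ ν : NCMeasure d} (h : μ ≤ ν) : μ.quadForm ≤ ν.quadForm :=
  ⟨le_rfl, fun _ => h _ (ContinuousLinearMap.isPositive_adjoint_comp_self _)⟩

theorem eq_of_quadForm_le {μ ν : NCMeasure d} (h1 : μ.quadForm ≤ ν.quadForm)
    (h2 : ν.quadForm ≤ μ.quadForm) : μ = ν :=
  ext_of_quadForm fun a => le_antisymm (h1.2 (diskEquiv d a)) (h2.2 (diskEquiv d a))

protected theorem le_antisymm {μ ν : NCMeasure d} (h1 : μ ≤ ν) (h2 : ν ≤ μ) : μ = ν :=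
  eq_of_quadForm_le (quadForm_le_quadForm h1) (quadForm_le_quadForm h2)

/-- If `ν ≤ μ`, then `ν` and `μ` extend to positive functionals on all operators in the same order:
extend `ν` and `μ - ν` separately. -/
theorem exists_vectorMeasure_of_le {μ ν : NCMeasure d} (h : ν ≤ μ) :
    ∃ (K : Type) (_ : NormedAddCommGroup K) (_ : InnerProductSpace ℂ K) (_ : CompleteSpace K)
      (π : (Fock d →L[ℂ] Fock d) →⋆ₐ[ℂ] (K →L[ℂ] K)) (ξ : K)
      (K' : Type) (_ : NormedAddCommGroup K') (_ : InnerProductSpace ℂ K') (_ : CompleteSpace K')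
      (π' : (Fock d →L[ℂ] Fock d) →⋆ₐ[ℂ] (K' →L[ℂ] K')) (ξ' : K'),
      μ = vectorMeasure π ξ ∧ ν = vectorMeasure π' ξ' ∧ ∀ b, ‖π' b ξ'‖ ≤ ‖π b ξ‖ := by
  let σ : NCMeasure d := ⟨μ.toFun - ν.toFun, fun s hs => sub_nonneg.mpr (h s hs)⟩
  obtain ⟨φ, hφ⟩ := ν.exists_positive_extension
  obtain ⟨ψ, hψ⟩ := σ.exists_positive_extension
  let χ : (Fock d →L[ℂ] Fock d) →ₚ[ℂ] ℂ :=
    PositiveLinearMap.mk₀ (φ.toLinearMap + ψ.toLinearMap) fun b hb =>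
      add_nonneg (φ.map_nonneg hb) (ψ.map_nonneg hb)
  have hχ : ∀ b, χ b = φ b + ψ b := fun _ => rfl
  obtain ⟨K, _, _, _, π, ξ, hπ⟩ := exists_representation χ
  obtain ⟨K', _, _, _, π', ξ', hπ'⟩ := exists_representation φ
  refine ⟨K, _, _, _, π, ξ, K', _, _, _, π', ξ', NCMeasure.ext (LinearMap.ext fun s => ?_),
    NCMeasure.ext (LinearMap.ext fun s => (hφ s).symm.trans (hπ' s)), fun b => ?_⟩
  · rw [vectorMeasure_apply, ← hπ, hχ, hφ, hψ]
    exact (add_sub_cancel (ν.toFun s) (μ.toFun s)).symm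
  · have h1 : φ (star b * b) ≤ χ (star b * b) := by
      rw [hχ]
      exact le_add_of_nonneg_right (ψ.map_nonneg (star_mul_self_nonneg b))
    rw [hπ, hπ', inner_map_star_mul_self, inner_map_star_mul_self, Complex.real_le_real] at h1
    exact le_of_sq_le_sq h1 (norm_nonneg _)

/-- An absolutely continuous NC measure below `μ` is below the NC measure of the regular vector in
any representation of `μ`. -/
theorem IsAC.le_regularVector {ν : NCMeasure d} (hac : ν.IsAC) (hle : ν ≤ vectorMeasure π ξ) :
    ν ≤ vectorMeasure π (regularVector π ξ) := by
  obtain ⟨K₁, _, _, _, π₁, ξ₁, K', _, _, _, π', ξ', hμ, rfl, hdom⟩ :=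
    exists_vectorMeasure_of_le hle
  have h := vectorMeasure_le_regularVector hdom hac
  -- Both regular parts have the largest closable form below the form of `μ`.
  have hreg : vectorMeasure π₁ (regularVector π₁ ξ₁) = vectorMeasure π (regularVector π ξ) := by
    refine eq_of_quadForm_le (le_quadForm_regularVector isAC_vectorMeasure_regularVector ?_)
      (le_quadForm_regularVector isAC_vectorMeasure_regularVector ?_)
    · rw [hμ]
      exact quadForm_le_quadForm vectorMeasure_regularVector_le
    · rw [← hμ]
      exact quadForm_le_quadForm vectorMeasure_regularVector_le
  rwa [hreg] at h

end NCMeasure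

end Decomposition

end NCLebesgue

end

theorem theorem4p2 (d : ℕ) (μ : NCLebesgue.NCMeasure d) :
    ∃ μac μs : NCLebesgue.NCMeasure d,
      (μ = μac + μs ∧ μac ≤ μ ∧ μs ≤ μ) ∧
      -- `μac` is the largest absolutely continuous NC measure below `μ`
      IsGreatest {ν : NCLebesgue.NCMeasure d | ν.IsAC ∧ ν ≤ μ} μac ∧
      -- moreover its form is the largest closable form below `q_μ`
      IsGreatest {q : NCLebesgue.PosForm (NCLebesgue.Fock d) | q.IsClosable ∧ q ≤ μ.quadForm}
        μac.quadForm ∧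
      μs.IsSingular ∧
      -- uniqueness
      ∀ ν σ : NCLebesgue.NCMeasure d, μ = ν + σ →
        Maximal (fun ρ : NCLebesgue.NCMeasure d => ρ.IsAC ∧ ρ ≤ μ) ν → ν = μac ∧ σ = μs := by
  obtain ⟨K, _, _, _, π, ξ, rfl⟩ := μ.exists_eq_vectorMeasure
  set μac := NCLebesgue.vectorMeasure π (NCLebesgue.regularVector π ξ) with hμac
  set μs := NCLebesgue.vectorMeasure π (NCLebesgue.singularVector π ξ) with hμs
  have hadd : NCLebesgue.vectorMeasure π ξ = μac + μs := NCLebesgue.vectorMeasure_eq_add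
  have hac : μac.IsAC := NCLebesgue.isAC_vectorMeasure_regularVector
  have hle : μac ≤ NCLebesgue.vectorMeasure π ξ := hadd ▸ μac.le_self_add μs
  refine ⟨μac, μs, ⟨hadd, hle, hadd ▸ μac.le_add_self μs⟩,
    ⟨⟨hac, hle⟩, fun ν hν => hν.1.le_regularVector hν.2⟩,
    ⟨⟨hac, NCLebesgue.NCMeasure.quadForm_le_quadForm hle⟩,
      fun q hq => NCLebesgue.le_quadForm_regularVector hq.1 hq.2⟩,
    NCLebesgue.isSingular_vectorMeasure_singularVector, fun ν σ hsum hmax => ?_⟩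
  have hν : ν ≤ μac := hmax.1.1.le_regularVector hmax.1.2
  obtain rfl : ν = μac := NCLebesgue.NCMeasure.le_antisymm hν (hmax.2 ⟨hac, hle⟩ hν)
  exact ⟨rfl, NCLebesgue.NCMeasure.add_left_cancel (hsum.symm.trans hadd)⟩
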